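/- Let $\mathcal{Q}$ be a small quantaloid, i.e. a small category whose hom-sets are complete lattices and whose composition preserves arbitrary suprema in each variable. A small $\mathcal{Q}$-category $(X,a)$ is a set $X$ with an extent $|x|\in\operatorname{ob}\mathcal{Q}$ for each $x\in X$ and arrows $a(x,y):|x|\to|y|$ such that $1_{|x|}\le a(x,x)$ and $a(y,z)\circ a(x,y)\le a(x,z)$ for all $x,y,z\in X$. A $\mathcal{Q}$-functor $f:(X,a)\to(Y,b)$ is a map $f:X\to Y$ with $|f(x)|=|x|$ and $a(x,y)\le b(f(x),f(y))$ for all $x,y\in X$. A $\mathcal{Q}$-distributor $\varphi$ from $(X,a)$ to $(Y,b)$ is a family of arrows $\varphi(x,y):|x|\to|y|$ $(x\in X,\ y\in Y)$ such that $b(y,y')\circ\varphi(x,y)\circ a(x',x)\le\varphi(x',y')$ for all $x,x'\in X$ and $y,y'\in Y$. Let $\mathcal{Q}\text{-}\mathbf{Chu}$ be the category whose objects are the $\mathcal{Q}$-distributors between small $\mathcal{Q}$-categories. A morphism (a $\mathcal{Q}$-Chu transform) from $\varphi$, a distributor from $X$ to $W$, to $\psi$, a distributor from $Y$ to $Z$,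 is a pair $(f,g)$ of $\mathcal{Q}$-functors $f:X\to Y$ and $g:Z\to W$ such that $\psi(f(x),z)=\varphi(x,g(z))$ for all $x\in X$ and $z\in Z$. Composition is $(f',g')\circ(f,g)=(f'\circ f,\;g\circ g')$. A category $\mathcal{C}$ with small hom-sets is called - *totally cocomplete* if a diagram $D:\mathcal{J}\to\mathcal{C}$ has a colimit whenever the colimit of $\mathcal{C}(A,D-):\mathcal{J}\to\mathbf{Set}$ exists in $\mathbf{Set}$ for every object $A$ of $\mathcal{C}$; - *totally complete* if a diagram $D:\mathcal{J}\to\mathcal{C}$ has a limit whenever the colimit of $\mathcal{C}(D-,A):\mathcal{J}^{\mathrm{op}}\to\mathbf{Set}$ exists in $\mathbf{Set}$ for every object $A$ of $\mathcal{C}$; - *hypercomplete* if a diagram $D:\mathcal{J}\to\mathcal{C}$ has a limit whenever the limit of $\mathcal{C}(A,D-):\mathcal{J}\to\mathbf{Set}$ exists in $\mathbf{Set}$ for every object $A$ of $\mathcal{C}$; - *hypercocomplete* if a diagram $D:\mathcal{J}\to\mathcal{C}$ has a colimit whenever the limit of $\mathcal{C}(D-,A):\mathcal{J}^{\mathrm{op}}\to\mathbf{Set}$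 exists in $\mathbf{Set}$ for every object $A$ of $\mathcal{C}$. Here $\mathbf{Set}$ is the category of small sets, and the diagrams $D$ may be of any size (small or large). Then $\mathcal{Q}\text{-}\mathbf{Chu}$ is totally complete and totally cocomplete and, in particular, hypercocomplete and hypercomplete. -/

import Mathlib

open CategoryTheory

universe u w w'

/-- A small quantaloid: a small category whose hom-sets are complete lattices such that composition
preserves arbitrary suprema in each variable. -/
class Quantaloid (Q : Type u) extends Category.{u} Q where
  homLattice (s t : Q) : CompleteLattice (s ⟶ t)
  comp_sSup {r s t : Q} (p : r ⟶ s) (S : Set (s ⟶ t)) : p ≫ sSup S = ⨆ q ∈ S, p ≫ q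
  sSup_comp {r s t : Q} (S : Set (r ⟶ s)) (q : s ⟶ t) : sSup S ≫ q = ⨆ p ∈ S, p ≫ q

namespace Quantaloid

attribute [reducible, instance] Quantaloid.homLattice

section Monotonicity

variable {Q : Type u} [Quantaloid Q]

theorem comp_le_comp {r s t : Q} {p p' : r ⟶ s} {q q' : s ⟶ t} (hp : p ≤ p') (hq : q ≤ q') :
    p ≫ q ≤ p' ≫ q' := by
  have h1 : p ≫ q ≤ p ≫ q' := by
    have h := comp_sSup p {q, q'}
    rw [sSup_pair, sup_eq_right.mpr hq, iSup_pair] at h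
    rw [h]
    exact le_sup_left
  have h2 : p ≫ q' ≤ p' ≫ q' := by
    have h := sSup_comp {p, p'} q'
    rw [sSup_pair, sup_eq_right.mpr hp, iSup_pair] at h
    rw [h]
    exact le_sup_left
  exact h1.trans h2

end Monotonicity

/-- A small `Q`-category: a set of objects, an extent for each object, and hom-arrows
`a(x, y) : |x| ⟶ |y|` with `1 ≤ a(x, x)` and `a(y, z) ∘ a(x, y) ≤ a(x, z)`. -/
structure QCategory (Q : Type u) [Quantaloid Q] : Type (u + 1) where
  Obj : Type u
  extent : Obj → Q
  hom (x y : Obj) : extent x ⟶ extent y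
  id_le (x : Obj) : 𝟙 (extent x) ≤ hom x x
  comp_le (x y z : Obj) : hom x y ≫ hom y z ≤ hom x z

/-- A `Q`-functor: an extent-preserving map with `a(x, y) ≤ b(f x, f y)`. The morphisms `eqToHom`
identify `|x|` with the equal object `|f x|`. -/
@[ext]
structure QFunctor {Q : Type u} [Quantaloid Q] (X Y : QCategory Q) : Type u where
  toFun : X.Obj → Y.Obj
  extent_eq (x : X.Obj) : X.extent x = Y.extent (toFun x)
  hom_le (x y : X.Obj) :
    X.hom x y ≤
      eqToHom (extent_eq x) ≫ Y.hom (toFun x) (toFun y) ≫ eqToHom (extent_eq y).symm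

/-- The identity `Q`-functor. -/
def QFunctor.id {Q : Type u} [Quantaloid Q] (X : QCategory Q) : QFunctor X X where
  toFun x := x
  extent_eq _ := rfl
  hom_le x y := by simp

/-- The composite `Q`-functor `g ∘ f`. -/
def QFunctor.comp {Q : Type u} [Quantaloid Q] {X Y Z : QCategory Q}
    (f : QFunctor X Y) (g : QFunctor Y Z) : QFunctor X Z where
  toFun x := g.toFun (f.toFun x)
  extent_eq x := (f.extent_eq x).trans (g.extent_eq (f.toFun x))
  hom_le x y := by
    refine (f.hom_le x y).trans ?_
    refine (comp_le_comp le_rfl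
      (comp_le_comp (g.hom_le (f.toFun x) (f.toFun y)) le_rfl)).trans (le_of_eq ?_)
    simp

/-- A `Q`-distributor `φ` from `X` to `Y`: arrows `φ(x, y) : |x| ⟶ |y|` with
`b(y, y') ∘ φ(x, y) ∘ a(x', x) ≤ φ(x', y')`. -/
structure QDistributor {Q : Type u} [Quantaloid Q] (X Y : QCategory Q) : Type u where
  arrow (x : X.Obj) (y : Y.Obj) : X.extent x ⟶ Y.extent y
  comp_le (x x' : X.Obj) (y y' : Y.Obj) :
    X.hom x' x ≫ arrow x y ≫ Y.hom y y' ≤ arrow x' y'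

/-- An object of `Q`-Chu: a `Q`-distributor between small `Q`-categories. -/
structure QChu (Q : Type u) [Quantaloid Q] : Type (u + 1) where
  dom : QCategory Q
  cod : QCategory Q
  dist : QDistributor dom cod

/-- A `Q`-Chu transform from `φ : X → W` to `ψ : Y → Z` (distributors): a pair of `Q`-functors
`f : X → Y` and `g : Z → W` with `ψ(f x, z) = φ(x, g z)`, where equal extents are identified. -/
@[ext]
structure ChuTransform {Q : Type u} [Quantaloid Q] (φ ψ : QChu Q) : Type u where
  f : QFunctor φ.dom ψ.dom
  g : QFunctor ψ.cod φ.cod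
  comm (x : φ.dom.Obj) (z : ψ.cod.Obj) :
    eqToHom (f.extent_eq x) ≫ ψ.dist.arrow (f.toFun x) z =
      φ.dist.arrow x (g.toFun z) ≫ eqToHom (g.extent_eq z).symm

/-- The category `Q`-Chu; composition is composition of `Q`-functors in both components. -/
instance QChu.category (Q : Type u) [Quantaloid Q] : Category.{u} (QChu Q) where
  Hom φ ψ := ChuTransform φ ψ
  id φ :=
    { f := QFunctor.id φ.dom
      g := QFunctor.id φ.cod
      comm := fun _ _ => (Category.id_comp _).trans (Category.comp_id _).symm }
  comp {φ ψ χ} F G :=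
    { f := F.f.comp G.f
      g := G.g.comp F.g
      comm := fun x z => by
        have h1 := G.comm (F.f.toFun x) z
        have h2 := F.comm x (G.g.toFun z)
        calc _ = eqToHom (F.f.extent_eq x) ≫ eqToHom (G.f.extent_eq (F.f.toFun x)) ≫
                χ.dist.arrow (G.f.toFun (F.f.toFun x)) z := by simp [QFunctor.comp]
          _ = _ := by
            rw [h1, ← Category.assoc, h2]
            simp [QFunctor.comp] }

end Quantaloid

section TotalCompleteness

/-- `C` is hypercomplete: a diagram `D : J ⥤ C`, with `J` of any size, has a limit whenever the
limit of `C(A, D -)` exists in sets for all `A`. -/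
def IsHypercomplete.{w₁, w₂, v₁, u₁} (C : Type u₁) [Category.{v₁} C] : Prop :=
  ∀ (J : Type w₁) [Category.{w₂} J] (D : J ⥤ C),
    (∀ A : C, Limits.HasLimit (D ⋙ coyoneda.obj (Opposite.op A))) → Limits.HasLimit D

/-- `C` is totally cocomplete: a diagram `D : J ⥤ C`, with `J` of any size, has a colimit whenever
the colimit of `C(A, D -)` exists in sets for all `A`. -/
def IsTotallyCocomplete.{w₁, w₂, v₁, u₁} (C : Type u₁) [Category.{v₁} C] : Prop :=
  ∀ (J : Type w₁) [Category.{w₂} J] (D : J ⥤ C),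
    (∀ A : C, Limits.HasColimit (D ⋙ coyoneda.obj (Opposite.op A))) → Limits.HasColimit D

/-- The dual of hypercompleteness: a diagram `D` has a colimit whenever the limit of `C(D -, A)`
exists in sets for all `A`. -/
def IsHypercocomplete.{w₁, w₂, v₁, u₁} (C : Type u₁) [Category.{v₁} C] : Prop :=
  ∀ (J : Type w₁) [Category.{w₂} J] (D : J ⥤ C),
    (∀ A : C, Limits.HasLimit (D.op ⋙ yoneda.obj A)) → Limits.HasColimit D

/-- The dual of total cocompleteness: a diagram `D` has a limit whenever the colimit of `C(D -, A)`
exists in sets for all `A`. -/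
def IsTotallyComplete.{w₁, w₂, v₁, u₁} (C : Type u₁) [Category.{v₁} C] : Prop :=
  ∀ (J : Type w₁) [Category.{w₂} J] (D : J ⥤ C),
    (∀ A : C, Limits.HasColimit (D.op ⋙ yoneda.obj A)) → Limits.HasLimit D

end TotalCompleteness

/-!
Total cocompleteness is a property of test objects. Corepresentability by a test object turns the
hypothesis on `C(A, D -)` into the existence of colimits or limits of sets, and for `Q`-Chu two
kinds of test objects suffice: the one-object `Q`-category of extent `s` paired with its
copresheaves, which corepresents the objects of extent `s` of the domain; and the empty `Q`-category
paired with an indiscrete one, which detects that the compatible families of objects of the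
codomains form a small set. The colimit of `D` is then the colimit of the domains, with its final
structure, paired with the limit of the codomains, with its initial structure. The final structure
acts correctly on the distributor because an action of a `Q`-category on arrows into `t` is the same
as a `Q`-functor to the `Q`-category of such arrows.

Exchanging domain and codomain identifies the opposite of `Q`-Chu with `Qᵒᵖ`-Chu, so `Q`-Chu is also
totally complete. Finally a totally cocomplete category is hypercomplete by an adjoint functor
theorem: the colimit of the projection from the category of cones over `D` underlies a colimit of
the identity functor of that category, hence a terminal cone.
-/

section TotalCategories

universe w₁ w₂ v₁ v₂ u₁ u₂

open Limits Opposite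

theorem hasTerminal_of_hasColimit_id (C : Type u₁) [Category.{v₁} C] [HasColimit (𝟭 C)] :
    HasTerminal C := by
  have ι_colimit : colimit.ι (𝟭 C) (colimit (𝟭 C)) = 𝟙 (colimit (𝟭 C)) :=
    colimit.hom_ext fun X =>
      (colimit.w (𝟭 C) (colimit.ι (𝟭 C) X)).trans (Category.comp_id _).symm
  refine (IsTerminal.ofUniqueHom (colimit.ι (𝟭 C)) fun X m => ?_).hasTerminal
  have w : m ≫ colimit.ι (𝟭 C) (colimit (𝟭 C)) = colimit.ι (𝟭 C) X := colimit.w (𝟭 C) m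
  rwa [ι_colimit, Category.comp_id] at w

section CostructuredArrow

variable {C : Type u₁} [Category.{v₁} C] {T : Type u₂} [Category.{v₂} T] (G : C ⥤ T) (X : T)

theorem hasColimit_costructuredArrow_proj_comp_coyoneda (A : C) [Small.{v₁} (G.obj A ⟶ X)] :
    HasColimit (CostructuredArrow.proj G X ⋙ coyoneda.obj (op A)) := by
  let F := CostructuredArrow.proj G X ⋙ coyoneda.obj (op A)
  rw [Types.hasColimit_iff_small_colimitType]
  -- Every class is represented by the identity of `A` over a comma object with source `A`.
  refine small_of_surjective (f := fun p : G.obj A ⟶ X =>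
    F.ιColimitType (CostructuredArrow.mk p) (𝟙 A)) fun x => ?_
  obtain ⟨c, (h : A ⟶ c.left), rfl⟩ := F.ιColimitType_jointly_surjective x
  let m : CostructuredArrow.mk (G.map h ≫ c.hom) ⟶ c := CostructuredArrow.homMk h
  exact ⟨G.map h ≫ c.hom, (F.ιColimitType_map m (𝟙 A)).symm.trans
    (congrArg (F.ιColimitType c) (Category.id_comp h))⟩

theorem IsTotallyCocomplete.hasTerminal_costructuredArrow
    (h : IsTotallyCocomplete.{max u₁ v₂, v₁} C) [PreservesColimitsOfSize.{v₁, max u₁ v₂} G]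
    [∀ A, Small.{v₁} (G.obj A ⟶ X)] : HasTerminal (CostructuredArrow G X) := by
  have : HasColimit (𝟭 (CostructuredArrow G X) ⋙ CostructuredArrow.proj G X) :=
    h _ _ fun A => hasColimit_costructuredArrow_proj_comp_coyoneda G X A
  exact hasTerminal_of_hasColimit_id _

end CostructuredArrow

variable {C : Type u₁} [Category.{v₁} C]

theorem IsTotallyCocomplete.isHypercomplete
    (h : IsTotallyCocomplete.{max w₁ u₁ v₁, v₁} C) : IsHypercomplete.{w₁, w₂} C := by
  intro J _ D hD
  have (A : C) : Small.{v₁} ((Functor.const J).obj A ⟶ D) :=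
    (small_congr (compCoyonedaSectionsEquiv D A)).1
      ((Types.hasLimit_iff_small_sections _).1 (hD A))
  have := h.hasTerminal_costructuredArrow (Functor.const J) D
  exact (hasLimit_iff_hasTerminal_cone D).2 ((Cone.equivCostructuredArrow D).hasTerminal_iff.2 this)

theorem IsTotallyCocomplete.of_equivalence {C' : Type u₂} [Category.{v₁} C'] (e : C ≌ C')
    (h : IsTotallyCocomplete.{w₁, w₂} C) : IsTotallyCocomplete.{w₁, w₂} C' := by
  intro J _ D hD
  have : HasColimit (D ⋙ e.inverse) := h J _ fun A => by
    have := hD (e.functor.obj A)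
    let homIso : D ⋙ coyoneda.obj (op (e.functor.obj A)) ≅
        (D ⋙ e.inverse) ⋙ coyoneda.obj (op A) :=
      NatIso.ofComponents (fun j => (e.toAdjunction.homEquiv A (D.obj j)).toIso) fun m => by
        ext p
        exact e.toAdjunction.homEquiv_naturality_right p (D.map m)
    exact hasColimit_of_iso homIso.symm
  exact Adjunction.hasColimit_of_comp_equivalence D e.inverse

theorem IsTotallyCocomplete.isTotallyComplete_of_op (h : IsTotallyCocomplete.{w₁, w₂} Cᵒᵖ) :
    IsTotallyComplete.{w₁, w₂} C := by
  intro J _ D hD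
  have : HasColimit D.op := h Jᵒᵖ D.op fun A =>
    have := hD A.unop
    hasColimit_of_iso (Functor.isoWhiskerLeft D.op (Coyoneda.objOpOp A.unop))
  exact hasLimit_of_hasColimit_op D

theorem IsHypercomplete.isHypercocomplete_of_op (h : IsHypercomplete.{w₁, w₂} Cᵒᵖ) :
    IsHypercocomplete.{w₁, w₂} C := by
  intro J _ D hD
  have : HasLimit D.op := h Jᵒᵖ D.op fun A =>
    have := hD A.unop
    hasLimit_of_iso (Functor.isoWhiskerLeft D.op (Coyoneda.objOpOp A.unop)).symm
  exact hasColimit_of_hasLimit_op D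

theorem hasLimit_of_hasColimit_rightOp_comp_yoneda {J : Type w₁} [Category.{w₂} J]
    (F : Jᵒᵖ ⥤ Type v₁) (T : Type v₁) [Nontrivial T] [HasColimit (F.rightOp ⋙ yoneda.obj T)] :
    HasLimit F := by
  rw [Types.hasLimit_iff_small_sections]
  let evaluation (z : F.sections) : Cocone (F.rightOp ⋙ yoneda.obj T) :=
    { pt := T
      ι :=
        { app := fun j => ↾fun h : F.obj (op j) ⟶ T => h (z.1 (op j))
          naturality := fun j k m => by
            ext h
            exact congrArg (ConcreteCategory.hom (h : F.obj (op j) ⟶ T)) (z.2 m.op) } }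
  have desc_evaluation (z : F.sections) (j : J) (h : F.obj (op j) ⟶ T) :
      colimit.desc _ (evaluation z) (colimit.ι (F.rightOp ⋙ yoneda.obj T) j h) = h (z.1 (op j)) :=
    colimit.ι_desc_apply (evaluation z) j h
  refine small_of_injective (β := colimit (F.rightOp ⋙ yoneda.obj T) ⟶ T)
    (f := fun z => colimit.desc _ (evaluation z))
    fun z z' hzz' => Subtype.ext (funext fun j => ?_)
  by_contra hne
  obtain ⟨a, b, hab⟩ := exists_pair_ne T
  classical
  let h : F.obj j ⟶ T := ↾fun x => if x = z.1 j then a else b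
  have heval : h (z.1 j) = h (z'.1 j) := by
    rw [← desc_evaluation z, ← desc_evaluation z']
    exact ConcreteCategory.congr_hom hzz' _
  exact hab (by simpa [h, Ne.symm hne] using heval)

end TotalCategories

namespace Quantaloid

universe v v₂

variable {Q : Type u} [Quantaloid Q]

section Residuation

variable {r s t : Q}

/-- The right residual of `q` along `p`: the largest arrow `c` with `p ≫ c ≤ q`. -/
def rightResidual (p : r ⟶ s) (q : r ⟶ t) : s ⟶ t := sSup {c | p ≫ c ≤ q}

/-- The left residual of `q` along `p`: the largest arrow `c` with `c ≫ p ≤ q`. -/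
def leftResidual (p : s ⟶ t) (q : r ⟶ t) : r ⟶ s := sSup {c | c ≫ p ≤ q}

theorem le_rightResidual_iff {p : r ⟶ s} {q : r ⟶ t} {c : s ⟶ t} :
    c ≤ rightResidual p q ↔ p ≫ c ≤ q := by
  refine ⟨fun h => (comp_le_comp le_rfl h).trans ?_, fun h => le_sSup h⟩
  rw [rightResidual, comp_sSup]
  exact iSup₂_le fun _ h => h

theorem le_leftResidual_iff {p : s ⟶ t} {q : r ⟶ t} {c : r ⟶ s} :
    c ≤ leftResidual p q ↔ c ≫ p ≤ q := by
  refine ⟨fun h => (comp_le_comp h le_rfl).trans ?_, fun h => le_sSup h⟩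
  rw [leftResidual, sSup_comp]
  exact iSup₂_le fun _ h => h

end Residuation

/-- A `Q`-category structure on a family of sets `X`, where `X s` is the set of objects of
extent `s`. Indexing the objects by their extent makes the transport of arrows along equalities of
extents unnecessary. -/
@[ext]
structure QStructure (X : Q → Type v) where
  hom {s t : Q} (x : X s) (y : X t) : s ⟶ t
  id_le {s : Q} (x : X s) : 𝟙 s ≤ hom x x
  comp_le {r s t : Q} (x : X r) (y : X s) (z : X t) : hom x y ≫ hom y z ≤ hom x z

namespace QStructure

section Lattice

variable {X : Q → Type v}

instance : PartialOrder (QStructure X) where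
  le a b := ∀ ⦃s t : Q⦄ (x : X s) (y : X t), a.hom x y ≤ b.hom x y
  le_refl _ _ _ _ _ := le_rfl
  le_trans _ _ _ hab hbc _ _ x y := (hab x y).trans (hbc x y)
  le_antisymm _ _ hab hba := by
    ext s t x y
    exact (hab x y).antisymm (hba x y)

instance : InfSet (QStructure X) where
  sInf S :=
    { hom := fun x y => ⨅ a ∈ S, a.hom x y
      id_le := fun x => le_iInf₂ fun a _ => a.id_le x
      comp_le := fun x y z => le_iInf₂ fun a ha =>
        (comp_le_comp (iInf₂_le a ha) (iInf₂_le a ha)).trans (a.comp_le x y z) }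

instance : CompleteLattice (QStructure X) :=
  completeLatticeOfInf _ fun _ =>
    ⟨fun a ha _ _ _ _ => iInf₂_le a ha, fun _ hb _ _ x y => le_iInf₂ fun _ ha => hb ha x y⟩

end Lattice

section Functoriality

variable {X : Q → Type v} {Y : Q → Type v₂}

/-- The initial structure along `f`: the largest one making `f` a `Q`-functor into `b`. Hence
`a ≤ b.comap f` says that `f` is a `Q`-functor from `a` to `b`. -/
def comap (f : ∀ s, X s → Y s) (b : QStructure Y) : QStructure X where
  hom {s t} x y := b.hom (f s x) (f t y)
  id_le {s} x := b.id_le (f s x)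
  comp_le {r s t} x y z := b.comp_le (f r x) (f s y) (f t z)

/-- The final structure along `f`: the smallest one making `f` a `Q`-functor from `a`. -/
def map (f : ∀ s, X s → Y s) (a : QStructure X) : QStructure Y := sInf {b | a ≤ b.comap f}

theorem gc_map_comap (f : ∀ s, X s → Y s) : GaloisConnection (map f) (comap f) := fun _ _ =>
  ⟨fun h _ _ x y => (le_iInf₂ fun _ hb => hb x y).trans (h (f _ x) (f _ y)), fun h => sInf_le h⟩

end Functoriality

/-- The `Q`-category of arrows into `t`, that is, of presheaves on the one-object `Q`-category of
extent `t`. -/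
def presheaf (t : Q) : QStructure (fun s : Q => s ⟶ t) where
  hom p q := leftResidual q p
  id_le p := le_leftResidual_iff.2 (Category.id_comp p).le
  comp_le p q r := by
    rw [le_leftResidual_iff, Category.assoc]
    exact (comp_le_comp le_rfl (le_leftResidual_iff.1 le_rfl)).trans (le_leftResidual_iff.1 le_rfl)

/-- The `Q`-category of arrows out of `s`, that is, of copresheaves on the one-object `Q`-category
of extent `s`. -/
def copresheaf (s : Q) : QStructure (fun t : Q => s ⟶ t) where
  hom p q := rightResidual p q
  id_le p := le_rightResidual_iff.2 (Category.comp_id p).le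
  comp_le p q r := by
    rw [le_rightResidual_iff, ← Category.assoc]
    exact (comp_le_comp (le_rightResidual_iff.1 le_rfl) le_rfl).trans
      (le_rightResidual_iff.1 le_rfl)

variable {X : Q → Type v} {a : QStructure X}

theorem le_comap_presheaf_iff {t : Q} {p : ∀ s, X s → (s ⟶ t)} :
    a ≤ (presheaf t).comap p ↔
      ∀ ⦃r s : Q⦄ (x : X r) (y : X s), a.hom x y ≫ p s y ≤ p r x :=
  forall₄_congr fun _ _ _ _ => le_leftResidual_iff

theorem le_comap_copresheaf_iff {s : Q} {p : ∀ t, X t → (s ⟶ t)} :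
    a ≤ (copresheaf s).comap p ↔
      ∀ ⦃r t : Q⦄ (x : X r) (y : X t), p r x ≫ a.hom x y ≤ p t y :=
  forall₄_congr fun _ _ _ _ => le_rightResidual_iff

end QStructure

/-- A `Q`-distributor between `Q`-categories whose objects are indexed by their extent. The two
actions of the hom-arrows are required separately. -/
structure GradedChu (Q : Type u) [Quantaloid Q] : Type (u + 1) where
  dom : Q → Type u
  cod : Q → Type u
  domStr : QStructure dom
  codStr : QStructure cod
  arrow {s t : Q} (x : dom s) (y : cod t) : s ⟶ t
  hom_arrow_le {r s t : Q} (x' : dom r) (x : dom s) (y : cod t) :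
    domStr.hom x' x ≫ arrow x y ≤ arrow x' y
  arrow_hom_le {r s t : Q} (x : dom r) (y : cod s) (y' : cod t) :
    arrow x y ≫ codStr.hom y y' ≤ arrow x y'

namespace GradedChu

/-- A `Q`-Chu transform between distributors whose objects are indexed by their extent. -/
@[ext]
structure Hom (φ ψ : GradedChu Q) : Type u where
  f (s : Q) : φ.dom s → ψ.dom s
  g (t : Q) : ψ.cod t → φ.cod t
  domStr_le : φ.domStr ≤ ψ.domStr.comap f
  codStr_le : ψ.codStr ≤ φ.codStr.comap g
  comm {s t : Q} (x : φ.dom s) (z : ψ.cod t) : ψ.arrow (f s x) z = φ.arrow x (g t z)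

instance : Category.{u} (GradedChu Q) where
  Hom := Hom
  id φ := ⟨fun _ x => x, fun _ z => z, le_rfl, le_rfl, fun _ _ => rfl⟩
  comp F G :=
    { f := fun s x => G.f s (F.f s x)
      g := fun t z => F.g t (G.g t z)
      domStr_le := fun _ _ x y => (F.domStr_le x y).trans (G.domStr_le _ _)
      codStr_le := fun _ _ z z' => (G.codStr_le z z').trans (F.codStr_le _ _)
      comm := fun x z => (G.comm _ z).trans (F.comm x _) }

theorem hom_ext {φ ψ : GradedChu Q} {F G : φ ⟶ ψ} (hf : ∀ s x, F.f s x = G.f s x)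
    (hg : ∀ t z, F.g t z = G.g t z) : F = G :=
  Hom.ext (funext₂ hf) (funext₂ hg)

/-- The functor sending a distributor to the objects of extent `s` of its domain. -/
def domFiber (s : Q) : GradedChu Q ⥤ Type u where
  obj φ := φ.dom s
  map F := ↾F.f s

/-- The functor sending a distributor to the objects of extent `t` of its codomain. -/
def codFiber (t : Q) : (GradedChu Q)ᵒᵖ ⥤ Type u where
  obj φ := φ.unop.cod t
  map F := ↾F.unop.g t

section TestObjects

open Opposite

/-- The family of sets whose only element has extent `s`. -/
inductive Point (s : Q) : Q → Type u
  | pt : Point s s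

/-- The one-object `Q`-category of extent `s` with its distributor to its copresheaves. -/
def point (s : Q) : GradedChu Q where
  dom := Point s
  cod t := s ⟶ t
  domStr := ⊥
  codStr := QStructure.copresheaf s
  arrow := fun .pt p => p
  hom_arrow_le {_ _ t} x' x p :=
    QStructure.le_comap_presheaf_iff.1
      (bot_le (a := (QStructure.presheaf t).comap fun _ (.pt : Point s _) => p)) x' x
  arrow_hom_le := fun .pt _ _ => le_rightResidual_iff.1 le_rfl

/-- The transform out of `point s` classifying an element `x` of extent `s`. -/
def pointHom {s : Q} {φ : GradedChu Q} (x : φ.dom s) : point s ⟶ φ where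
  f _ := fun .pt => x
  g _ z := φ.arrow x z
  domStr_le := bot_le
  codStr_le := QStructure.le_comap_copresheaf_iff.2 fun _ _ => φ.arrow_hom_le x
  comm := fun .pt _ => rfl

/-- `point s` corepresents `domFiber s`. -/
def coyonedaPointIso (s : Q) : coyoneda.obj (op (point s)) ≅ domFiber s :=
  NatIso.ofComponents (fun φ => Equiv.toIso
    { toFun := fun F : Hom (point s) φ => F.f s .pt
      invFun := pointHom
      left_inv := fun F => hom_ext (fun _ => fun .pt => rfl) (fun _ z => F.comm .pt z)
      right_inv := fun _ => rfl }) fun _ => rfl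

/-- The distributor from the empty `Q`-category to the indiscrete `Q`-category whose objects of
extent `t` are the elements of `T`, and which has one object of every other extent. -/
def indiscrete (t : Q) (T : Type u) : GradedChu Q where
  dom _ := PEmpty
  cod s := s = t → T
  domStr := ⊤
  codStr := ⊤
  arrow := nofun
  hom_arrow_le := nofun
  arrow_hom_le := nofun

/-- `indiscrete t T` corepresents the functor of `T`-valued functions on the objects of extent `t`
of the codomain. -/
def coyonedaIndiscreteIso (t : Q) (T : Type u) :
    coyoneda.obj (op (indiscrete t T)) ≅ (codFiber t).rightOp ⋙ yoneda.obj T :=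
  NatIso.ofComponents (fun φ => Equiv.toIso
    { toFun := fun F : Hom (indiscrete t T) φ => ↾fun z => F.g t z rfl
      invFun := fun h : φ.cod t ⟶ T =>
        { f := nofun
          g := fun _ z e => h (e ▸ z)
          domStr_le := nofun
          codStr_le := (QStructure.gc_map_comap _).le_u le_top
          comm := nofun }
      left_inv := fun F => hom_ext nofun fun _ _ => funext fun e => by subst e; rfl
      right_inv := fun _ => rfl }) fun _ => rfl

end TestObjects

section Colimit

open Limits Opposite

variable {J : Type w} [Category.{w'} J] (D : J ⥤ GradedChu Q)

section Dom

variable [∀ s, HasColimit (D ⋙ domFiber s)]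

/-- The objects of extent `s` of the colimit of the domains. -/
noncomputable abbrev colimitDom (s : Q) : Type u := colimit (D ⋙ domFiber s)

/-- The coprojection of the domain of `D.obj j` into the colimit of the domains. -/
noncomputable def inj (j : J) (s : Q) (x : (D.obj j).dom s) : colimitDom D s :=
  colimit.ι (D ⋙ domFiber s) j x

theorem inj_map {j k : J} (m : j ⟶ k) {s : Q} (x : (D.obj j).dom s) :
    inj D k s ((D.map m).f s x) = inj D j s x :=
  colimit.w_apply (D ⋙ domFiber s) m x

theorem exists_inj_eq {s : Q} (x : colimitDom D s) : ∃ j x', inj D j s x' = x :=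
  Types.jointly_surjective' x

/-- The map out of the colimit of the domains induced by a cocone over `D`. -/
noncomputable def descDom (c : Cocone D) (s : Q) : colimitDom D s → c.pt.dom s :=
  colimit.desc (D ⋙ domFiber s) ((domFiber s).mapCocone c)

theorem descDom_inj (c : Cocone D) (j : J) (s : Q) (x : (D.obj j).dom s) :
    descDom D c s (inj D j s x) = (c.ι.app j).f s x :=
  colimit.ι_desc_apply ((domFiber s).mapCocone c) j x

end Dom

variable [∀ t, HasLimit (D.op ⋙ codFiber t)]

/-- The objects of extent `t` of the limit of the codomains. -/
noncomputable abbrev limitCod (t : Q) : Type u := limit (D.op ⋙ codFiber t)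

/-- The projection of the limit of the codomains onto the codomain of `D.obj j`. -/
noncomputable def proj (j : J) (t : Q) (z : limitCod D t) : (D.obj j).cod t :=
  limit.π (D.op ⋙ codFiber t) (op j) z

theorem map_proj {j k : J} (m : j ⟶ k) {t : Q} (z : limitCod D t) :
    (D.map m).g t (proj D k t z) = proj D j t z :=
  limit.w_apply (D.op ⋙ codFiber t) m.op z

theorem proj_ext {t : Q} {z z' : limitCod D t} (h : ∀ j, proj D j t z = proj D j t z') : z = z' :=
  Types.limit_ext _ _ _ fun j => h j.unop

/-- The map into the limit of the codomains induced by a cocone over `D`. -/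
noncomputable def liftCod (c : Cocone D) (t : Q) : c.pt.cod t → limitCod D t :=
  limit.lift (D.op ⋙ codFiber t) ((codFiber t).mapCone c.op)

theorem proj_liftCod (c : Cocone D) (j : J) (t : Q) (z : c.pt.cod t) :
    proj D j t (liftCod D c t z) = (c.ι.app j).g t z :=
  limit.lift_π_apply ((codFiber t).mapCone c.op) (op j) z

/-- The cocone formed by the functions `x ↦ φⱼ(x, zⱼ)`, where `φⱼ` is `D.obj j` and `zⱼ` the
`j`-th component of `z`. -/
noncomputable def arrowCocone (s : Q) {t : Q} (z : limitCod D t) : Cocone (D ⋙ domFiber s) where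
  pt := s ⟶ t
  ι :=
    { app := fun j => ↾fun x => (D.obj j).arrow x (proj D j t z)
      naturality := fun j k m => by
        ext x
        exact ((D.map m).comm x _).trans (congrArg _ (map_proj D m z)) }

variable [∀ s, HasColimit (D ⋙ domFiber s)]

/-- The arrows of the colimit of `D`. -/
noncomputable def colimitArrow {s t : Q} (x : colimitDom D s) (z : limitCod D t) : s ⟶ t :=
  (colimit.desc (D ⋙ domFiber s) (arrowCocone D s z) : colimitDom D s → (s ⟶ t)) x

theorem colimitArrow_inj (j : J) {s t : Q} (x : (D.obj j).dom s) (z : limitCod D t) :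
    colimitArrow D (inj D j s x) z = (D.obj j).arrow x (proj D j t z) :=
  colimit.ι_desc_apply (arrowCocone D s z) j x

theorem iSup_map_inj_hom_comp_colimitArrow_le {r s t : Q} (x : colimitDom D r)
    (y : colimitDom D s) (z : limitCod D t) :
    (⨆ j, (D.obj j).domStr.map (inj D j)).hom x y ≫ colimitArrow D y z ≤ colimitArrow D x z := by
  have le_comap_presheaf : ⨆ j, (D.obj j).domStr.map (inj D j) ≤
      (QStructure.presheaf t).comap fun _ x => colimitArrow D x z :=
    iSup_le fun j => (QStructure.gc_map_comap _).l_le fun r s x y => by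
      simp only [QStructure.comap, colimitArrow_inj]
      exact le_leftResidual_iff.2 ((D.obj j).hom_arrow_le x y _)
  exact QStructure.le_comap_presheaf_iff.1 le_comap_presheaf x y

theorem colimitArrow_comp_iInf_comap_proj_hom_le {r s t : Q} (x : colimitDom D r)
    (z : limitCod D s) (z' : limitCod D t) :
    colimitArrow D x z ≫ (⨅ j, (D.obj j).codStr.comap (proj D j)).hom z z' ≤
      colimitArrow D x z' := by
  obtain ⟨j, x, rfl⟩ := exists_inj_eq D x
  rw [colimitArrow_inj, colimitArrow_inj]
  exact (comp_le_comp le_rfl (iInf_le (fun j => (D.obj j).codStr.comap (proj D j)) j z z')).trans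
    ((D.obj j).arrow_hom_le x _ _)

/-- The vertex of the colimit of `D`: the colimit of the domains with its final structure, and the
limit of the codomains with its initial structure. -/
noncomputable def colimitObj : GradedChu Q where
  dom := colimitDom D
  cod := limitCod D
  domStr := ⨆ j, (D.obj j).domStr.map (inj D j)
  codStr := ⨅ j, (D.obj j).codStr.comap (proj D j)
  arrow := colimitArrow D
  hom_arrow_le := iSup_map_inj_hom_comp_colimitArrow_le D
  arrow_hom_le := colimitArrow_comp_iInf_comap_proj_hom_le D

/-- The cocone of the coprojections and projections. -/
noncomputable def colimitCocone : Cocone D where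
  pt := colimitObj D
  ι :=
    { app := fun j =>
        { f := inj D j
          g := proj D j
          domStr_le := (QStructure.gc_map_comap _).le_u
            (le_iSup (fun j => (D.obj j).domStr.map (inj D j)) j)
          codStr_le := iInf_le _ j
          comm := colimitArrow_inj D j }
      naturality := fun _ _ m => hom_ext (fun _ => inj_map D m) fun _ => map_proj D m }

/-- The transform out of the colimit induced by a cocone over `D`. -/
noncomputable def colimitDesc (c : Cocone D) : colimitObj D ⟶ c.pt where
  f := descDom D c
  g := liftCod D c
  domStr_le := iSup_le fun j => (QStructure.gc_map_comap _).l_le fun s t x y => by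
    simp only [QStructure.comap, descDom_inj]
    exact (c.ι.app j).domStr_le x y
  codStr_le := (QStructure.gc_map_comap _).le_u <| le_iInf fun j =>
    (QStructure.gc_map_comap _).l_le fun s t z z' => by
      simp only [QStructure.comap, proj_liftCod]
      exact (c.ι.app j).codStr_le z z'
  comm x z := by
    obtain ⟨j, x, rfl⟩ := exists_inj_eq D x
    refine Eq.trans ?_ (colimitArrow_inj D j x _).symm
    rw [descDom_inj, proj_liftCod]
    exact (c.ι.app j).comm x z

theorem hasColimit : HasColimit D := by
  refine ⟨⟨colimitCocone D,
    { desc := colimitDesc D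
      fac := fun c j => hom_ext (descDom_inj D c j) (proj_liftCod D c j)
      uniq := fun c F hF => hom_ext (fun s x => ?_) fun t z => proj_ext D fun j => ?_ }⟩⟩
  · obtain ⟨j, x, rfl⟩ := exists_inj_eq D x
    exact (congrArg (fun G : Hom _ _ => G.f s x) (hF j)).trans (descDom_inj D c j s x).symm
  · exact (congrArg (fun G : Hom _ _ => G.g t z) (hF j)).trans (proj_liftCod D c j t z).symm

end Colimit

variable (Q) in
theorem isTotallyCocomplete : IsTotallyCocomplete.{w, w'} (GradedChu Q) := by
  intro J _ D hD
  have (s : Q) : Limits.HasColimit (D ⋙ domFiber s) :=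
    have := hD (point s)
    Limits.hasColimit_of_iso (Functor.isoWhiskerLeft D (coyonedaPointIso s)).symm
  have (t : Q) : Limits.HasLimit (D.op ⋙ codFiber t) :=
    have := hD (indiscrete t (ULift Bool))
    have : Limits.HasColimit ((D.op ⋙ codFiber t).rightOp ⋙ yoneda.obj (ULift Bool)) :=
      Limits.hasColimit_of_iso
        (Functor.isoWhiskerLeft D (coyonedaIndiscreteIso t (ULift Bool))).symm
    hasLimit_of_hasColimit_rightOp_comp_yoneda _ (ULift Bool)
  exact hasColimit D

end GradedChu

section Total

/-- The `Q`-category whose objects are the pairs of an extent `s` and an element of `X s`. -/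
def QStructure.total {X : Q → Type u} (a : QStructure X) : QCategory Q where
  Obj := Σ s, X s
  extent := Sigma.fst
  hom x y := a.hom x.2 y.2
  id_le x := a.id_le x.2
  comp_le x y z := a.comp_le x.2 y.2 z.2

/-- The `Q`-functor given by a family of maps indexed by the extent. -/
def QStructure.totalFunctor {X Y : Q → Type u} {a : QStructure X} {b : QStructure Y}
    (f : ∀ s, X s → Y s) (hf : a ≤ b.comap f) : QFunctor a.total b.total where
  toFun x := ⟨x.1, f x.1 x.2⟩
  extent_eq _ := rfl
  hom_le x y := (hf x.2 y.2).trans ((Category.id_comp _).trans (Category.comp_id _)).ge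

theorem QStructure.exists_totalFunctor_eq {X Y : Q → Type u} {a : QStructure X}
    {b : QStructure Y} (F : QFunctor a.total b.total) : ∃ f hf, totalFunctor f hf = F := by
  obtain ⟨F, extent_eq, hom_le⟩ := F
  have exists_eq (s : Q) (x : X s) : ∃ y : Y s, F ⟨s, x⟩ = ⟨s, y⟩ := by
    have hs : s = (F ⟨s, x⟩).1 := extent_eq ⟨s, x⟩
    generalize F ⟨s, x⟩ = y at hs
    obtain ⟨t, y⟩ := y
    obtain rfl : s = t := hs
    exact ⟨y, rfl⟩
  choose f hf using exists_eq
  obtain rfl : F = fun x => ⟨x.1, f x.1 x.2⟩ := funext fun x => hf x.1 x.2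
  exact ⟨f, fun s t x y => (hom_le ⟨s, x⟩ ⟨t, y⟩).trans
    ((Category.id_comp _).trans (Category.comp_id _)).le, rfl⟩

/-- The structure of a `Q`-category on the family of its sets of objects of given extent. -/
def QCategory.fiberStructure (X : QCategory Q) :
    QStructure fun s => {x : X.Obj // X.extent x = s} where
  hom x y := eqToHom x.2.symm ≫ X.hom x.1 y.1 ≫ eqToHom y.2
  id_le := by
    rintro _ ⟨x, rfl⟩
    simpa using X.id_le x
  comp_le := by
    rintro _ _ _ ⟨x, rfl⟩ ⟨y, rfl⟩ ⟨z, rfl⟩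
    simpa using X.comp_le x y z

/-- The `Q`-functor forgetting that the objects were sorted by their extent. -/
def QCategory.ofTotalFiber (X : QCategory Q) : QFunctor X.fiberStructure.total X where
  toFun x := x.2.1
  extent_eq x := x.2.2.symm
  hom_le _ _ := le_rfl

/-- The `Q`-functor sorting the objects by their extent. -/
def QCategory.toTotalFiber (X : QCategory Q) : QFunctor X X.fiberStructure.total where
  toFun x := ⟨X.extent x, x, rfl⟩
  extent_eq _ := rfl
  hom_le x y := by simp [QCategory.fiberStructure, QStructure.total]

theorem QCategory.ofTotalFiber_comp_toTotalFiber (X : QCategory Q) :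
    X.ofTotalFiber.comp X.toTotalFiber = QFunctor.id X.fiberStructure.total :=
  QFunctor.ext <| funext fun | ⟨_, _, rfl⟩ => rfl

theorem QDistributor.hom_comp_arrow_le {X Y : QCategory Q} (φ : QDistributor X Y) (x' x : X.Obj)
    (y : Y.Obj) : X.hom x' x ≫ φ.arrow x y ≤ φ.arrow x' y :=
  calc X.hom x' x ≫ φ.arrow x y = X.hom x' x ≫ φ.arrow x y ≫ 𝟙 (Y.extent y) := by
        rw [Category.comp_id]
    _ ≤ X.hom x' x ≫ φ.arrow x y ≫ Y.hom y y :=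
        comp_le_comp le_rfl (comp_le_comp le_rfl (Y.id_le y))
    _ ≤ φ.arrow x' y := φ.comp_le x x' y y

theorem QDistributor.arrow_comp_hom_le {X Y : QCategory Q} (φ : QDistributor X Y) (x : X.Obj)
    (y z : Y.Obj) : φ.arrow x y ≫ Y.hom y z ≤ φ.arrow x z :=
  calc φ.arrow x y ≫ Y.hom y z = 𝟙 (X.extent x) ≫ φ.arrow x y ≫ Y.hom y z := by
        rw [Category.id_comp]
    _ ≤ X.hom x x ≫ φ.arrow x y ≫ Y.hom y z := comp_le_comp (X.id_le x) le_rfl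
    _ ≤ φ.arrow x z := φ.comp_le x x y z

/-- The distributor with the objects of both `Q`-categories sorted by their extent. -/
def QChu.graded (φ : QChu Q) : GradedChu Q where
  dom s := {x : φ.dom.Obj // φ.dom.extent x = s}
  cod t := {y : φ.cod.Obj // φ.cod.extent y = t}
  domStr := φ.dom.fiberStructure
  codStr := φ.cod.fiberStructure
  arrow x y := eqToHom x.2.symm ≫ φ.dist.arrow x.1 y.1 ≫ eqToHom y.2
  hom_arrow_le := by
    rintro _ _ _ ⟨x', rfl⟩ ⟨x, rfl⟩ ⟨y, rfl⟩
    simpa [QCategory.fiberStructure] using φ.dist.hom_comp_arrow_le x' x y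
  arrow_hom_le := by
    rintro _ _ _ ⟨x, rfl⟩ ⟨y, rfl⟩ ⟨y', rfl⟩
    simpa [QCategory.fiberStructure] using φ.dist.arrow_comp_hom_le x y y'

namespace GradedChu

variable (Q) in
/-- The functor collecting the objects of all extents; it is an equivalence of categories. -/
def total : GradedChu Q ⥤ QChu Q where
  obj φ :=
    { dom := φ.domStr.total
      cod := φ.codStr.total
      dist :=
        { arrow := fun x y => φ.arrow x.2 y.2
          comp_le := fun x x' y y' =>
            (comp_le_comp le_rfl (φ.arrow_hom_le x.2 y.2 y'.2)).trans
              (φ.hom_arrow_le x'.2 x.2 y'.2) } }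
  map F :=
    { f := QStructure.totalFunctor F.f F.domStr_le
      g := QStructure.totalFunctor F.g F.codStr_le
      comm := fun x z => (Category.id_comp _).trans
        ((F.comm x.2 z.2).trans (Category.comp_id _).symm) }

instance : (total Q).Faithful where
  map_injective {φ ψ F G} h := by
    have hf := congrArg (fun T : ChuTransform ((total Q).obj φ) ((total Q).obj ψ) => T.f.toFun) h
    have hg := congrArg (fun T : ChuTransform ((total Q).obj φ) ((total Q).obj ψ) => T.g.toFun) h
    exact hom_ext (fun s x => eq_of_heq (Sigma.mk.inj (congrFun hf ⟨s, x⟩)).2)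
      fun t z => eq_of_heq (Sigma.mk.inj (congrFun hg ⟨t, z⟩)).2

instance : (total Q).Full where
  map_surjective {φ ψ} F := by
    obtain ⟨F, G, comm⟩ := F
    obtain ⟨f, hf, rfl⟩ := QStructure.exists_totalFunctor_eq F
    obtain ⟨g, hg, rfl⟩ := QStructure.exists_totalFunctor_eq G
    exact ⟨⟨f, g, hf, hg, fun {s t} x z => (Category.id_comp _).symm.trans
      ((comm ⟨s, x⟩ ⟨t, z⟩).trans (Category.comp_id _))⟩, rfl⟩

instance : (total Q).EssSurj where
  mem_essImage φ :=
    let ofTotal : (total Q).obj φ.graded ⟶ φ :=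
      { f := φ.dom.ofTotalFiber
        g := φ.cod.toTotalFiber
        comm := fun _ _ =>
          (congrArg (eqToHom _ ≫ ·) (Category.comp_id _).symm).trans (Category.comp_id _).symm }
    let toTotal : φ ⟶ (total Q).obj φ.graded :=
      { f := φ.dom.toTotalFiber
        g := φ.cod.ofTotalFiber
        comm := fun _ _ => (Category.id_comp _).trans (Category.id_comp _) }
    ⟨φ.graded, ⟨ofTotal, toTotal, ChuTransform.ext φ.dom.ofTotalFiber_comp_toTotalFiber
      φ.cod.ofTotalFiber_comp_toTotalFiber, rfl⟩⟩

instance : (total Q).IsEquivalence where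

end GradedChu

end Total

section Opposite

open Opposite

/-- The order of the hom-sets of `Q`, transported to the hom-sets of `Qᵒᵖ`. -/
@[reducible]
def opHomLattice (s t : Qᵒᵖ) : CompleteLattice (s ⟶ t) := (opEquiv s t).completeLattice

instance : Quantaloid Qᵒᵖ where
  homLattice := opHomLattice
  comp_sSup {r s t} p S := by
    let := @opHomLattice Q _
    have gc : GaloisConnection (fun q : s ⟶ t => p ≫ q)
        fun c => (leftResidual p.unop c.unop).op := fun _ _ => le_leftResidual_iff.symm
    exact gc.l_sSup
  sSup_comp {r s t} S p := by
    let := @opHomLattice Q _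
    have gc : GaloisConnection (fun q : r ⟶ s => q ≫ p)
        fun c => (rightResidual p.unop c.unop).op := fun _ _ => le_rightResidual_iff.symm
    exact gc.l_sSup

/-- The opposite structure, on the same family of objects. -/
def QStructure.op {X : Q → Type v} (a : QStructure X) : QStructure fun s : Qᵒᵖ => X s.unop where
  hom x y := (a.hom y x).op
  id_le x := a.id_le x
  comp_le x y z := a.comp_le z y x

/-- The structure with a given opposite. -/
def QStructure.unop {X : Qᵒᵖ → Type v} (a : QStructure X) :
    QStructure fun s : Q => X (Opposite.op s) where
  hom x y := (a.hom y x).unop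
  id_le x := a.id_le x
  comp_le x y z := a.comp_le z y x

namespace GradedChu

variable (Q) in
/-- The duality between `Q`-distributors and `Qᵒᵖ`-distributors, which exchanges domain and
codomain. -/
def opEquivalence : (GradedChu Q)ᵒᵖ ≌ GradedChu Qᵒᵖ where
  functor :=
    { obj := fun φ =>
        { dom := fun t => φ.unop.cod t.unop
          cod := fun s => φ.unop.dom s.unop
          domStr := φ.unop.codStr.op
          codStr := φ.unop.domStr.op
          arrow := fun x y => (φ.unop.arrow y x).op
          hom_arrow_le := fun x' x y => φ.unop.arrow_hom_le y x x'
          arrow_hom_le := fun x y y' => φ.unop.hom_arrow_le y' y x }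
      map := fun F =>
        { f := fun t => F.unop.g t.unop
          g := fun s => F.unop.f s.unop
          domStr_le := fun _ _ x y => F.unop.codStr_le y x
          codStr_le := fun _ _ x y => F.unop.domStr_le y x
          comm := fun x z => congrArg Quiver.Hom.op (F.unop.comm z x).symm } }
  inverse :=
    { obj := fun ψ => op
        { dom := fun s => ψ.cod (op s)
          cod := fun t => ψ.dom (op t)
          domStr := ψ.codStr.unop
          codStr := ψ.domStr.unop
          arrow := fun x y => (ψ.arrow y x).unop
          hom_arrow_le := fun x' x y => ψ.arrow_hom_le y x x'
          arrow_hom_le := fun x y y' => ψ.hom_arrow_le y' y x }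
      map := fun F => Quiver.Hom.op
        { f := fun s => F.g (op s)
          g := fun t => F.f (op t)
          domStr_le := fun _ _ x y => F.codStr_le y x
          codStr_le := fun _ _ x y => F.domStr_le y x
          comm := fun x z => congrArg Quiver.Hom.unop (F.comm z x).symm } }
  unitIso := Iso.refl _
  counitIso := Iso.refl _

end GradedChu

end Opposite

variable (Q)

theorem QChu.isTotallyCocomplete : IsTotallyCocomplete.{w, w'} (QChu Q) :=
  (GradedChu.isTotallyCocomplete Q).of_equivalence (GradedChu.total Q).asEquivalence

theorem QChu.isTotallyCocomplete_op : IsTotallyCocomplete.{w, w'} (QChu Q)ᵒᵖ :=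
  (GradedChu.isTotallyCocomplete Qᵒᵖ).of_equivalence
    ((GradedChu.opEquivalence Q).symm.trans (GradedChu.total Q).asEquivalence.op)

end Quantaloid

theorem mainTheorem1 (Q : Type u) [Quantaloid.{u} Q] :
    IsTotallyComplete.{w, w'} (Quantaloid.QChu Q) ∧
      IsTotallyCocomplete.{w, w'} (Quantaloid.QChu Q) ∧
      IsHypercocomplete.{w, w'} (Quantaloid.QChu Q) ∧
      IsHypercomplete.{w, w'} (Quantaloid.QChu Q) :=
  ⟨(Quantaloid.QChu.isTotallyCocomplete_op Q).isTotallyComplete_of_op,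
    Quantaloid.QChu.isTotallyCocomplete Q,
    (Quantaloid.QChu.isTotallyCocomplete_op Q).isHypercomplete.isHypercocomplete_of_op,
    (Quantaloid.QChu.isTotallyCocomplete Q).isHypercomplete⟩
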